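/- Let $n\ge 1$ and let $K\subset\mathbb{R}^n$ be a convex body, i.e. a compact convex set with nonempty interior. Let $C(K)$ be the space of continuous functions $f:K\to\mathbb{R}$ with the norm $\|f\|_{C(K)}=\max_{x\in K}|f(x)|$, and let $\Pi_1(\mathbb{R}^n)$ be the space of polynomials in $n$ variables of degree at most $1$. For points $x^{(1)},\dots,x^{(n+1)}\in K$ that are the vertices of a nondegenerate simplex $S$, let $P_S:C(K)\to\Pi_1(\mathbb{R}^n)$ be the interpolation projector with these nodes, i.e. the linear operator with $P_Sf(x^{(j)})=f(x^{(j)})$ for all $f\in C(K)$ and $1\le j\le n+1$; let $\|P_S\|_K$ be its norm as an operator from $C(K)$ to $C(K)$. Put $$\theta_n(K)=\min_S\|P_S\|_K,\qquad \mathrm{simp}_n(K)=\max_S\mathrm{vol}(S),$$ where $S$ runs over all nondegenerate simplices with vertices in $K$. Let $$\chi_n(t)=\frac{1}{2^n n!}\,\frac{d^n}{dt^n}\,(t^2-1)^n$$ be the standardized Legendre polynomial of degree $n$, and let $\chi_n^{-1}$ be the inverse of its restriction to $[1,\infty)$. Then these quantities are well defined: $\chi_n$ maps $[1,\infty)$ bijectively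 onto $[1,\infty)$, the minimum $\theta_n(K)$ and the maximum $\mathrm{simp}_n(K)$ are attained, and $\mathrm{vol}(K)/\mathrm{simp}_n(K)\ge 1$. Moreover, $$\theta_n(K)\ \ge\ \chi_n^{-1}\!\left(\frac{\mathrm{vol}(K)}{\mathrm{simp}_n(K)}\right).$$ -/

import Mathlib

open Set MeasureTheory

noncomputable section

namespace LinearInterpolation

/-- The standardized Legendre polynomial of degree `n` (Rodrigues' formula):
`(1 / (2 ^ n * n!)) * (d/dt)^n (t ^ 2 - 1) ^ n`. -/
def legendre (n : ℕ) : Polynomial ℝ :=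
  Polynomial.C (1 / (2 ^ n * (n.factorial : ℝ))) *
    (Polynomial.derivative^[n] ((Polynomial.X ^ 2 - 1) ^ n))

/-- The inverse of the function `t ↦ legendre n t` on the semi-axis `[1, ∞)`. -/
def legendreInv (n : ℕ) : ℝ → ℝ :=
  Function.invFunOn (fun t : ℝ => (legendre n).eval t) (Ici 1)

variable {n : ℕ}

instance compactSpaceBody (K : ConvexBody (EuclideanSpace ℝ (Fin n))) : CompactSpace K :=
  isCompact_iff_compactSpace.mp K.isCompact

/-- The points `x 0, …, x n` of `K` are the vertices of a nondegenerate simplex. -/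
def Nondegenerate {K : ConvexBody (EuclideanSpace ℝ (Fin n))} (x : Fin (n + 1) → K) : Prop :=
  AffineIndependent ℝ (fun j => (x j : EuclideanSpace ℝ (Fin n)))

/-- The volume of the simplex with vertices `x 0, …, x n`. -/
def simplexVolume {K : ConvexBody (EuclideanSpace ℝ (Fin n))} (x : Fin (n + 1) → K) : ℝ :=
  volume.real (convexHull ℝ (range fun j => (x j : EuclideanSpace ℝ (Fin n))))

/-- The volumes of the nondegenerate simplices with vertices in `K`. -/
def simplexVolumes (K : ConvexBody (EuclideanSpace ℝ (Fin n))) : Set ℝ :=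
  {v | ∃ x : Fin (n + 1) → K, Nondegenerate x ∧ v = simplexVolume x}

/-- The maximal volume of a nondegenerate simplex with vertices in `K`. -/
def maxSimplexVolume (K : ConvexBody (EuclideanSpace ℝ (Fin n))) : ℝ :=
  sSup (simplexVolumes K)

/-- `P` is the linear interpolation projector with nodes `x 0, …, x n`: every `P f` is (the
restriction to `K` of) a polynomial of degree at most one, which agrees with `f` at the nodes.
`C(K, ℝ)` carries the uniform norm, so `‖P‖` is the operator norm of `P` from `C(K)` to `C(K)`. -/
structure IsInterpolationProjector {K : ConvexBody (EuclideanSpace ℝ (Fin n))}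
    (x : Fin (n + 1) → K) (P : C(K, ℝ) →L[ℝ] C(K, ℝ)) : Prop where
  linear : ∀ f : C(K, ℝ), ∃ (a : Fin n → ℝ) (b : ℝ), ∀ y : K,
    P f y = ∑ i, a i * (y : EuclideanSpace ℝ (Fin n)) i + b
  interpolates : ∀ (f : C(K, ℝ)) (j : Fin (n + 1)), P f (x j) = f (x j)

/-- The norms of the interpolation projectors whose nodes are the vertices of a nondegenerate
simplex with vertices in `K`. -/
def projectorNorms (K : ConvexBody (EuclideanSpace ℝ (Fin n))) : Set ℝ :=
  {r | ∃ (x : Fin (n + 1) → K) (P : C(K, ℝ) →L[ℝ] C(K, ℝ)),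
    Nondegenerate x ∧ IsInterpolationProjector x P ∧ r = ‖P‖}

/-- The minimal norm of a linear interpolation projector on `K`. -/
def theta (K : ConvexBody (EuclideanSpace ℝ (Fin n))) : ℝ :=
  sInf (projectorNorms K)

end LinearInterpolation

end

/-!
Let `λ j` be the barycentric coordinates of a nondegenerate simplex `S` with vertices in `K`. The
projector with these nodes is `P f = ∑ f (x j) λ j`, and its norm is the maximum over `K` of the
Lebesgue function `∑ |λ j|` (`IsInterpolationProjector.norm_eq`). Hence `K` lies in the set where
`∑ |λ j| ≤ γ`, with `γ = ‖P‖ ≥ 1`.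

That set has volume exactly `legendre n γ * vol S`. Indeed, put `γ = 1 + 2 u`. Since `∑ λ j = 1`,
the condition `∑ |λ j| ≤ γ` means that the positive parts of `λ 1, …, λ n` sum to at most `1 + u`
and their negative parts to at most `u`: the coordinate `λ 0` drops out. In each orthant this is a
product of two corner simplices, so the volume in these coordinates is
`∑ C(n, k) (1 + u) ^ (n - k) / (n - k)! * u ^ k / k!` (`volume_signedSimplex`, proved by slicing).
Times `n!` this is Leibniz' formula for `legendre n (1 + 2 u)` (`factorial_mul_signedVolume`),
while `S` itself has volume `1 / n!` in the same coordinates. Only the inclusion into the signed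
simplex is needed, and it gives `vol K ≤ legendre n γ * vol S`
(`volume_real_le_legendre_mul_simplexVolume`). The estimate follows because `legendre n` increases
strictly on `[1, ∞)`.

The volume of a simplex is a continuous function of its vertices (an absolute value of a
determinant over `n!`), so the maximal volume is attained on the compact set of all tuples. The
inequality above also bounds `vol S` from below when `‖P‖` is bounded. Thus the minimal norm may be
sought on a compact set of nondegenerate simplices, where it depends continuously on the vertices.
-/

namespace LinearInterpolation

/-! ### Legendre polynomials -/

open Polynomial in
/-- Leibniz' rule applied to Rodrigues' formula with `t ^ 2 - 1 = (t - 1) (t + 1)`, evaluated at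
`t = 1 + 2 * u`. -/
theorem eval_legendre_one_add_two_mul (n : ℕ) (u : ℝ) :
    (legendre n).eval (1 + 2 * u) =
      ∑ k ∈ Finset.range (n + 1), (n.choose k : ℝ) ^ 2 * ((1 + u) ^ (n - k) * u ^ k) := by
  have h : ((X ^ 2 - 1 : ℝ[X]) ^ n) = (X - C 1) ^ n * (X + C 1) ^ n := by
    rw [← mul_pow]; congr 1; simp; ring
  rw [legendre, h, iterate_derivative_mul, eval_mul, eval_C, eval_finsetSum, Finset.mul_sum]
  refine Finset.sum_congr rfl fun k hk => ?_
  have hk : k ≤ n := by simpa [Nat.lt_succ_iff] using hk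
  rw [iterate_derivative_X_sub_pow, iterate_derivative_X_add_pow]
  have h1 : (n.descFactorial (n - k) : ℝ) = n.factorial / k.factorial := by
    rw [eq_div_iff (by positivity), mul_comm]
    have := Nat.factorial_mul_descFactorial (Nat.sub_le n k)
    rw [Nat.sub_sub_self hk] at this
    exact_mod_cast this
  have h2 : (n.descFactorial k : ℝ) = n.factorial / (n - k).factorial := by
    rw [eq_div_iff (by positivity), mul_comm]
    exact_mod_cast Nat.factorial_mul_descFactorial hk
  have h3 : (n.choose k : ℝ) = n.factorial / (k.factorial * (n - k).factorial) :=
    Nat.cast_choose ℝ hk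
  have h4 : (2 : ℝ) ^ n = 2 ^ k * 2 ^ (n - k) := by rw [← pow_add, Nat.add_sub_cancel' hk]
  have e1 : (1 + 2 * u - 1) = 2 * u := by ring
  have e2 : (1 + 2 * u + 1) = 2 * (1 + u) := by ring
  simp only [eval_mul, eval_pow, eval_sub, eval_add, eval_X, eval_C, eval_natCast,
    nsmul_eq_mul, Nat.sub_sub_self hk, e1, e2, mul_pow, h1, h2, h3, h4]
  field_simp

theorem strictMonoOn_legendre {n : ℕ} (hn : 1 ≤ n) :
    StrictMonoOn (fun t : ℝ => (legendre n).eval t) (Ici 1) := by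
  intro s hs t _ hst
  obtain ⟨u, rfl⟩ : ∃ u : ℝ, s = 1 + 2 * u := ⟨(s - 1) / 2, by ring⟩
  obtain ⟨v, rfl⟩ : ∃ v : ℝ, t = 1 + 2 * v := ⟨(t - 1) / 2, by ring⟩
  have hu : 0 ≤ u := by have := mem_Ici.1 hs; linarith
  have huv : u < v := by linarith
  simp only [eval_legendre_one_add_two_mul]
  refine Finset.sum_lt_sum (fun k _ => by
    have : 0 ≤ 1 + u := by linarith
    have : 0 ≤ 1 + v := by linarith
    gcongr) ⟨0, by simp, ?_⟩
  simpa using pow_lt_pow_left₀ (by linarith : 1 + u < 1 + v) (by linarith) (by omega)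

theorem eval_legendre_one (n : ℕ) : (legendre n).eval 1 = 1 := by
  have h := eval_legendre_one_add_two_mul n 0
  rw [Finset.sum_eq_single 0 (fun k _ hk => by simp [hk]) (by simp)] at h
  simpa using h

theorem one_add_le_eval_legendre {n : ℕ} (hn : 1 ≤ n) {u : ℝ} (hu : 0 ≤ u) :
    1 + u ≤ (legendre n).eval (1 + 2 * u) := by
  rw [eval_legendre_one_add_two_mul]
  calc 1 + u ≤ (1 + u) ^ n := le_self_pow₀ (by linarith) (by omega)
    _ = (n.choose 0 : ℝ) ^ 2 * ((1 + u) ^ (n - 0) * u ^ 0) := by simp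
    _ ≤ _ := Finset.single_le_sum
        (f := fun k => (n.choose k : ℝ) ^ 2 * ((1 + u) ^ (n - k) * u ^ k))
        (fun k _ => by positivity) (by simp)

theorem bijOn_legendre {n : ℕ} (hn : 1 ≤ n) :
    BijOn (fun t : ℝ => (legendre n).eval t) (Ici 1) (Ici 1) := by
  have hm := strictMonoOn_legendre hn
  refine ⟨fun t ht => ?_, hm.injOn, fun y hy => ?_⟩
  · have := hm.monotoneOn self_mem_Ici ht ht
    simpa [eval_legendre_one] using this
  · have hy : 1 ≤ y := hy
    have hivt := intermediate_value_Icc (by linarith : (1 : ℝ) ≤ 1 + 2 * (y - 1))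
      (f := fun t : ℝ => (legendre n).eval t) (legendre n).continuous.continuousOn
    have hle := one_add_le_eval_legendre hn (by linarith : 0 ≤ y - 1)
    obtain ⟨t, ht, rfl⟩ := hivt ⟨by simpa [eval_legendre_one] using hy, by linarith⟩
    exact ⟨t, ht.1, rfl⟩

theorem one_le_eval_legendre {n : ℕ} (hn : 1 ≤ n) {t : ℝ} (ht : 1 ≤ t) :
    1 ≤ (legendre n).eval t :=
  (bijOn_legendre hn).mapsTo ht

theorem legendreInv_le {n : ℕ} (hn : 1 ≤ n) {r t : ℝ} (hr : 1 ≤ r) (ht : 1 ≤ t)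
    (h : r ≤ (legendre n).eval t) : legendreInv n r ≤ t := by
  have hmem : r ∈ (fun t : ℝ => (legendre n).eval t) '' Ici 1 := (bijOn_legendre hn).surjOn hr
  have h1 : legendreInv n r ∈ Ici (1 : ℝ) := Function.invFunOn_mem hmem
  have h2 : (legendre n).eval (legendreInv n r) = r := Function.invFunOn_eq hmem
  exact ((strictMonoOn_legendre hn).le_iff_le h1 ht).1 (by simpa [h2] using h)

/-! ### The volume of a signed simplex -/

/-- The vectors of `ℝⁿ` whose positive parts sum to at most `a` and whose negative parts sum to at
most `b`. For `a = 1`, `b = 0` this is the standard corner simplex. -/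
def signedSimplex (n : ℕ) (a b : ℝ) : Set (Fin n → ℝ) :=
  {c | ∑ i, max (c i) 0 ≤ a ∧ ∑ i, max (-c i) 0 ≤ b}

/-- The volume of `signedSimplex n a b` for nonnegative `a` and `b`; the summand `p` collects the orthants with `p.1`
nonnegative and `p.2` nonpositive coordinates, in each of which the signed simplex is the product
of two corner simplices. -/
noncomputable def signedVolume (n : ℕ) (a b : ℝ) : ℝ :=
  ∑ p ∈ Finset.HasAntidiagonal.antidiagonal n,
    (n.choose p.1 : ℝ) * (a ^ p.1 / p.1.factorial * (b ^ p.2 / p.2.factorial))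

theorem isClosed_signedSimplex (n : ℕ) (a b : ℝ) : IsClosed (signedSimplex n a b) :=
  IsClosed.inter
    (isClosed_le (f := fun c : Fin n → ℝ => ∑ i, max (c i) 0) (by fun_prop) continuous_const)
    (isClosed_le (f := fun c : Fin n → ℝ => ∑ i, max (-c i) 0) (by fun_prop) continuous_const)

theorem signedSimplex_eq_empty_of_left_neg {n : ℕ} {a : ℝ} (ha : a < 0) (b : ℝ) :
    signedSimplex n a b = ∅ :=
  eq_empty_of_forall_notMem fun c hc => by
    have : 0 ≤ ∑ i, max (c i) 0 := Finset.sum_nonneg fun i _ => le_max_right _ _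
    linarith [hc.1]

theorem signedSimplex_eq_empty_of_right_neg {n : ℕ} (a : ℝ) {b : ℝ} (hb : b < 0) :
    signedSimplex n a b = ∅ :=
  eq_empty_of_forall_notMem fun c hc => by
    have : 0 ≤ ∑ i, max (-c i) 0 := Finset.sum_nonneg fun i _ => le_max_right _ _
    linarith [hc.2]

theorem signedVolume_nonneg (n : ℕ) {a b : ℝ} (ha : 0 ≤ a) (hb : 0 ≤ b) :
    0 ≤ signedVolume n a b :=
  Finset.sum_nonneg fun p _ => by positivity

theorem integral_pow_div_factorial (a : ℝ) (m : ℕ) :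
    ∫ s in (0 : ℝ)..a, s ^ m / m.factorial = a ^ (m + 1) / (m + 1).factorial := by
  rw [intervalIntegral.integral_div, integral_pow, Nat.factorial_succ]
  push_cast
  field_simp
  simp

/-- Pascal's rule in integrated form: it matches slicing `signedSimplex (n + 1) a b` by the first
coordinate. -/
theorem signedVolume_succ (n : ℕ) (a b : ℝ) :
    signedVolume (n + 1) a b =
      (∫ s in (0 : ℝ)..a, signedVolume n s b) + ∫ s in (0 : ℝ)..b, signedVolume n a s := by
  have hi : ∀ (p : ℕ × ℕ) (x : ℝ) (m : ℕ), IntervalIntegrable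
      (fun s : ℝ => (n.choose p.1 : ℝ) * (s ^ m / m.factorial * x)) volume 0 a :=
    fun p x m => Continuous.intervalIntegrable (by fun_prop) _ _
  have hi' : ∀ (p : ℕ × ℕ) (x : ℝ) (m : ℕ), IntervalIntegrable
      (fun s : ℝ => (n.choose p.1 : ℝ) * (x * (s ^ m / m.factorial))) volume 0 b :=
    fun p x m => Continuous.intervalIntegrable (by fun_prop) _ _
  unfold signedVolume
  rw [Finset.sum_antidiagonal_choose_succ_mul
      (fun i j => a ^ i / i.factorial * (b ^ j / j.factorial)) n,
    intervalIntegral.integral_finsetSum fun p _ => hi _ _ _,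
    intervalIntegral.integral_finsetSum fun p _ => hi' _ _ _, add_comm]
  congr 1
  · refine Finset.sum_congr rfl fun p hp => ?_
    rw [intervalIntegral.integral_const_mul, intervalIntegral.integral_mul_const,
      integral_pow_div_factorial,
      Nat.choose_symm_of_eq_add (Finset.HasAntidiagonal.mem_antidiagonal.1 hp).symm]
  · refine Finset.sum_congr rfl fun p _ => ?_
    rw [intervalIntegral.integral_const_mul, intervalIntegral.integral_const_mul,
      integral_pow_div_factorial]

theorem continuous_signedVolume (n : ℕ) :
    Continuous fun p : ℝ × ℝ => signedVolume n p.1 p.2 := by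
  unfold signedVolume; fun_prop

theorem cons_mem_signedSimplex {n : ℕ} {a b s : ℝ} {c : Fin n → ℝ} :
    (Fin.cons s c : Fin (n + 1) → ℝ) ∈ signedSimplex (n + 1) a b ↔
      c ∈ signedSimplex n (a - max s 0) (b - max (-s) 0) := by
  simp only [signedSimplex, mem_ofPred_eq, Fin.sum_univ_succ, Fin.cons_zero, Fin.cons_succ,
    le_sub_iff_add_le, add_comm]

theorem volume_signedSimplex (n : ℕ) :
    ∀ {a b : ℝ}, 0 ≤ a → 0 ≤ b →
      volume (signedSimplex n a b) = ENNReal.ofReal (signedVolume n a b) := by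
  induction n with
  | zero =>
    intro a b ha hb
    have : signedSimplex 0 a b = univ := by ext; simp [signedSimplex, ha, hb]
    simp [this, signedVolume, volume_pi]
  | succ n ih =>
    intro a b ha hb
    have hmeas := (isClosed_signedSimplex (n + 1) a b).measurableSet
    have hmp := (volume_preserving_piFinSuccAbove (fun _ : Fin (n + 1) => ℝ) 0).symm
    -- The slices by the first coordinate are signed simplices with one of the two bounds lowered.
    have hslice : ∀ s : ℝ, volume (Prod.mk s ⁻¹'
        ((MeasurableEquiv.piFinSuccAbove (fun _ : Fin (n + 1) => ℝ) 0).symm ⁻¹'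
          signedSimplex (n + 1) a b)) =
        (Ioc 0 a).indicator (fun s => ENNReal.ofReal (signedVolume n (a - s) b)) s +
        (Icc (-b) 0).indicator (fun s => ENNReal.ofReal (signedVolume n a (b + s))) s := by
      intro s
      have hset : Prod.mk s ⁻¹'
          ((MeasurableEquiv.piFinSuccAbove (fun _ : Fin (n + 1) => ℝ) 0).symm ⁻¹'
            signedSimplex (n + 1) a b) = signedSimplex n (a - max s 0) (b - max (-s) 0) := by
        ext c
        rw [← cons_mem_signedSimplex]
        simp [MeasurableEquiv.piFinSuccAbove, Fin.insertNthEquiv]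
      rw [hset]
      rcases lt_or_ge 0 s with hs | hs
      · rw [max_eq_left hs.le, max_eq_right (by linarith : -s ≤ 0), sub_zero,
          indicator_of_notMem (s := Icc (-b) 0) (fun h => hs.not_ge h.2), add_zero]
        rcases le_or_gt s a with hsa | hsa
        · rw [ih (by linarith) hb, indicator_of_mem (s := Ioc 0 a) ⟨hs, hsa⟩]
        · rw [signedSimplex_eq_empty_of_left_neg (by linarith),
            indicator_of_notMem (fun h => hsa.not_ge h.2), measure_empty]
      · rw [max_eq_right hs, max_eq_left (by linarith : 0 ≤ -s), sub_zero, sub_neg_eq_add,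
          indicator_of_notMem (s := Ioc 0 a) (fun h => hs.not_gt h.1), zero_add]
        rcases le_or_gt (-b) s with hsb | hsb
        · rw [ih ha (by linarith), indicator_of_mem (s := Icc (-b) 0) ⟨hsb, hs⟩]
        · rw [signedSimplex_eq_empty_of_right_neg _ (by linarith),
            indicator_of_notMem (fun h => hsb.not_ge h.1), measure_empty]
    have hF1 : Continuous fun s : ℝ => signedVolume n (a - s) b :=
      (continuous_signedVolume n).comp (by fun_prop : Continuous fun s : ℝ => (a - s, b))
    have hF2 : Continuous fun s : ℝ => signedVolume n a (b + s) :=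
      (continuous_signedVolume n).comp (by fun_prop : Continuous fun s : ℝ => (a, b + s))
    have hI1 : ∫⁻ s in Ioc 0 a, ENNReal.ofReal (signedVolume n (a - s) b) =
        ENNReal.ofReal (∫ s in (0 : ℝ)..a, signedVolume n s b) := by
      rw [← ofReal_integral_eq_lintegral_ofReal
          (hF1.integrableOn_Icc.mono_set Ioc_subset_Icc_self)
          ((ae_restrict_iff' measurableSet_Ioc).2 (Filter.Eventually.of_forall fun s hs =>
            signedVolume_nonneg n (by linarith [hs.2]) hb)),
        ← intervalIntegral.integral_of_le ha,
        intervalIntegral.integral_comp_sub_left (fun s => signedVolume n s b)]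
      simp
    have hI2 : ∫⁻ s in Icc (-b) 0, ENNReal.ofReal (signedVolume n a (b + s)) =
        ENNReal.ofReal (∫ s in (0 : ℝ)..b, signedVolume n a s) := by
      rw [← ofReal_integral_eq_lintegral_ofReal hF2.integrableOn_Icc
          ((ae_restrict_iff' measurableSet_Icc).2 (Filter.Eventually.of_forall fun s hs =>
            signedVolume_nonneg n ha (by linarith [hs.1]))),
        integral_Icc_eq_integral_Ioc, ← intervalIntegral.integral_of_le (by linarith),
        intervalIntegral.integral_comp_add_left (fun s => signedVolume n a s)]
      simp
    rw [← hmp.measure_preimage hmeas.nullMeasurableSet, Measure.volume_eq_prod,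
      Measure.prod_apply (hmp.measurable hmeas)]
    simp only [hslice]
    rw [lintegral_add_left (hF1.measurable.ennreal_ofReal.indicator measurableSet_Ioc),
      lintegral_indicator measurableSet_Ioc,
      lintegral_indicator measurableSet_Icc, hI1, hI2, signedVolume_succ,
      ENNReal.ofReal_add]
    · exact intervalIntegral.integral_nonneg ha fun s hs => signedVolume_nonneg n hs.1 hb
    · exact intervalIntegral.integral_nonneg hb fun s hs => signedVolume_nonneg n ha hs.1

theorem signedVolume_one_zero (n : ℕ) : signedVolume n 1 0 = 1 / n.factorial := by
  rw [signedVolume, Finset.sum_eq_single (n, 0)]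
  · simp
  · rintro ⟨i, j⟩ hij hne
    have hij := Finset.HasAntidiagonal.mem_antidiagonal.1 hij
    have : j ≠ 0 := by rintro rfl; simp_all
    simp [this]
  · simp

theorem factorial_mul_signedVolume (n : ℕ) (u : ℝ) :
    n.factorial * signedVolume n (1 + u) u = (legendre n).eval (1 + 2 * u) := by
  rw [eval_legendre_one_add_two_mul, signedVolume, Finset.mul_sum,
    ← Finset.Nat.sum_antidiagonal_swap, Finset.Nat.sum_antidiagonal_eq_sum_range_succ_mk]
  refine Finset.sum_congr rfl fun k hk => ?_
  have hk : k ≤ n := by simpa [Nat.lt_succ_iff] using hk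
  simp only [Prod.fst_swap, Prod.snd_swap, Nat.choose_symm hk]
  rw [Nat.cast_choose ℝ hk]
  field_simp

/-! ### Barycentric coordinates -/

section Simplex

variable {n : ℕ}

/-- The matrix whose columns are the edge vectors `x (j + 1) - x 0`. -/
def edgeMatrix (x : Fin (n + 1) → EuclideanSpace ℝ (Fin n)) : Matrix (Fin n) (Fin n) ℝ :=
  Matrix.of fun i j => x j.succ i - x 0 i

/-- The affine map of `ℝⁿ` which sends the origin to `x 0` and the `j`-th basis vector to
`x (j + 1)`. -/
def simplexParam (x : Fin (n + 1) → EuclideanSpace ℝ (Fin n)) (c : Fin n → ℝ) :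
    EuclideanSpace ℝ (Fin n) :=
  WithLp.toLp 2 fun i => x 0 i + (edgeMatrix x).mulVec c i

/-- The inverse of `simplexParam x` when the points `x j` are affinely independent. -/
noncomputable def edgeCoords (x : Fin (n + 1) → EuclideanSpace ℝ (Fin n))
    (y : EuclideanSpace ℝ (Fin n)) : Fin n → ℝ :=
  (edgeMatrix x)⁻¹.mulVec fun i => y i - x 0 i

/-- The barycentric coordinates of `y` with respect to the points `x j`, when these are affinely
independent. -/
noncomputable def bary (x : Fin (n + 1) → EuclideanSpace ℝ (Fin n))
    (y : EuclideanSpace ℝ (Fin n)) : Fin (n + 1) → ℝ :=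
  Fin.cons (1 - ∑ i, edgeCoords x y i) (edgeCoords x y)

variable {x : Fin (n + 1) → EuclideanSpace ℝ (Fin n)}

theorem affineIndependent_iff_det_edgeMatrix_ne_zero :
    AffineIndependent ℝ x ↔ (edgeMatrix x).det ≠ 0 := by
  rw [affineIndependent_iff_linearIndependent_vsub ℝ x 0,
    ← linearIndependent_equiv (finSuccAboveEquiv (0 : Fin (n + 1))), ← isUnit_iff_ne_zero,
    ← Matrix.isUnit_iff_isUnit_det, ← Matrix.linearIndependent_cols_iff_isUnit,
    ← LinearMap.linearIndependent_iff (WithLp.linearEquiv 2 ℝ (Fin n → ℝ)).toLinearMap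
      (LinearEquiv.ker _)]
  exact Iff.rfl

theorem simplexParam_apply (x : Fin (n + 1) → EuclideanSpace ℝ (Fin n)) (c : Fin n → ℝ)
    (i : Fin n) :
    simplexParam x c i = (1 - ∑ j, c j) * x 0 i + ∑ j, c j * x j.succ i := by
  have h : simplexParam x c i = x 0 i + ∑ j, (x j.succ i - x 0 i) * c j := rfl
  simp only [h, sub_mul, Finset.sum_sub_distrib, Finset.sum_mul, mul_comm (c _)]
  ring

theorem simplexParam_edgeCoords (hx : (edgeMatrix x).det ≠ 0) (y : EuclideanSpace ℝ (Fin n)) :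
    simplexParam x (edgeCoords x y) = y := by
  ext i
  simp [simplexParam, edgeCoords, Matrix.mulVec_mulVec,
    Matrix.mul_nonsing_inv _ (isUnit_iff_ne_zero.2 hx)]

theorem edgeCoords_simplexParam (hx : (edgeMatrix x).det ≠ 0) (c : Fin n → ℝ) :
    edgeCoords x (simplexParam x c) = c := by
  simp [simplexParam, edgeCoords, Matrix.mulVec_mulVec,
    Matrix.nonsing_inv_mul _ (isUnit_iff_ne_zero.2 hx)]

theorem sum_bary (x : Fin (n + 1) → EuclideanSpace ℝ (Fin n)) (y : EuclideanSpace ℝ (Fin n)) :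
    ∑ j, bary x y j = 1 := by
  simp [bary, Fin.sum_univ_succ]

theorem sum_bary_mul (hx : (edgeMatrix x).det ≠ 0) (y : EuclideanSpace ℝ (Fin n)) (i : Fin n) :
    ∑ j, bary x y j * x j i = y i := by
  conv_rhs => rw [← simplexParam_edgeCoords hx y, simplexParam_apply]
  simp [bary, Fin.sum_univ_succ]

/-- Barycentric coordinates reproduce every polynomial of degree at most one. -/
theorem sum_bary_mul_affine (hx : (edgeMatrix x).det ≠ 0) (a : Fin n → ℝ) (b : ℝ)
    (y : EuclideanSpace ℝ (Fin n)) :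
    ∑ j, bary x y j * (∑ i, a i * x j i + b) = ∑ i, a i * y i + b := by
  simp only [mul_add, Finset.sum_add_distrib, ← Finset.sum_mul, sum_bary, one_mul,
    ← sum_bary_mul hx y, Finset.mul_sum]
  rw [Finset.sum_comm]
  congr 1
  exact Finset.sum_congr rfl fun i _ => Finset.sum_congr rfl fun j _ => by ring

theorem simplexParam_zero (x : Fin (n + 1) → EuclideanSpace ℝ (Fin n)) :
    simplexParam x 0 = x 0 := by
  ext i; simp [simplexParam_apply]

theorem simplexParam_single (x : Fin (n + 1) → EuclideanSpace ℝ (Fin n)) (j : Fin n) :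
    simplexParam x (Pi.single j 1) = x j.succ := by
  ext i; simp [simplexParam_apply, Pi.single_apply]

theorem bary_vertex (hx : (edgeMatrix x).det ≠ 0) (k : Fin (n + 1)) :
    bary x (x k) = Pi.single k 1 := by
  induction k using Fin.cases with
  | zero =>
    rw [← simplexParam_zero x, bary, edgeCoords_simplexParam hx]
    ext j
    induction j using Fin.cases <;> simp
  | succ k =>
    rw [← simplexParam_single x, bary, edgeCoords_simplexParam hx]
    ext j
    induction j using Fin.cases <;> simp [Pi.single_apply]

theorem exists_bary_eq_affine (x : Fin (n + 1) → EuclideanSpace ℝ (Fin n)) (j : Fin (n + 1)) :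
    ∃ (a : Fin n → ℝ) (b : ℝ), ∀ y, bary x y j = ∑ i, a i * y i + b := by
  have h : ∀ k : Fin n, ∃ (a : Fin n → ℝ) (b : ℝ), ∀ y, edgeCoords x y k = ∑ i, a i * y i + b :=
    fun k => ⟨(edgeMatrix x)⁻¹ k, -∑ i, (edgeMatrix x)⁻¹ k i * x 0 i, fun y => by
      simp only [edgeCoords, Matrix.mulVec, dotProduct, mul_sub, Finset.sum_sub_distrib]
      ring⟩
  choose a b hab using h
  induction j using Fin.cases with
  | zero =>
    refine ⟨fun i => -∑ k, a k i, 1 - ∑ k, b k, fun y => ?_⟩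
    simp only [bary, Fin.cons_zero, hab, Finset.sum_add_distrib, neg_mul, Finset.sum_mul,
      Finset.sum_neg_distrib]
    rw [Finset.sum_comm]
    ring
  | succ k => exact ⟨a k, b k, fun y => by simp [bary, hab]⟩

/-! ### Volumes of simplices and of sublevel sets of the Lebesgue function -/

theorem volume_simplexParam_image (x : Fin (n + 1) → EuclideanSpace ℝ (Fin n))
    (A : Set (Fin n → ℝ)) :
    volume (simplexParam x '' A) = ENNReal.ofReal |(edgeMatrix x).det| * volume A := by
  have hmp := EuclideanSpace.volume_preserving_symm_measurableEquiv_toLp (Fin n)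
  have h : simplexParam x '' A = (MeasurableEquiv.toLp 2 (Fin n → ℝ)).symm ⁻¹'
      ((fun z => WithLp.ofLp (x 0) + z) '' (Matrix.toLin' (edgeMatrix x) '' A)) := by
    rw [image_image, ← MeasurableEquiv.image_eq_preimage_symm, image_image]
    rfl
  rw [h, hmp.measure_preimage_equiv, image_add_left, measure_preimage_add,
    Measure.addHaar_image_linearMap, LinearMap.det_toLin']

theorem convexHull_range_eq_image_signedSimplex (x : Fin (n + 1) → EuclideanSpace ℝ (Fin n)) :
    convexHull ℝ (range x) = simplexParam x '' signedSimplex n 1 0 := by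
  have hS : signedSimplex n 1 0 = {c | (∀ i, 0 ≤ c i) ∧ ∑ i, c i ≤ 1} := by
    ext c
    have h0 : ∑ i, max (-c i) 0 ≤ 0 ↔ ∀ i, 0 ≤ c i := by
      rw [(Finset.sum_nonneg fun i _ => le_max_right (-c i) 0).ge_iff_eq',
        Finset.sum_eq_zero_iff_of_nonneg fun i _ => le_max_right _ _]
      simp
    simp only [signedSimplex, mem_ofPred_eq, h0]
    refine ⟨fun ⟨h1, h2⟩ => ⟨h2, ?_⟩, fun ⟨h2, h1⟩ => ⟨?_, h2⟩⟩ <;>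
      simpa [max_eq_left (h2 _)] using h1
  rw [hS]
  refine Subset.antisymm (convexHull_min ?_ ?_) ?_
  · rintro _ ⟨k, rfl⟩
    induction k using Fin.cases with
    | zero => exact ⟨0, by simp, simplexParam_zero x⟩
    | succ k =>
      refine ⟨Pi.single k 1, ⟨fun i => ?_, by simp⟩, simplexParam_single x k⟩
      by_cases h : i = k <;> simp [h]
  · rintro _ ⟨c, hc, rfl⟩ _ ⟨d, hd, rfl⟩ s t hs ht hst
    refine ⟨s • c + t • d, ⟨fun i => ?_, ?_⟩, ?_⟩
    · have := hc.1 i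
      have := hd.1 i
      simp only [Pi.add_apply, Pi.smul_apply, smul_eq_mul]
      positivity
    · simp only [Pi.add_apply, Pi.smul_apply, smul_eq_mul, Finset.sum_add_distrib,
        ← Finset.mul_sum]
      nlinarith [hc.2, hd.2]
    · ext i
      simp only [simplexParam, PiLp.add_apply, PiLp.smul_apply, smul_eq_mul, Matrix.mulVec_add,
        Matrix.mulVec_smul, Pi.add_apply, Pi.smul_apply]
      linear_combination (-(x 0 i)) * hst
  · rintro _ ⟨c, hc, rfl⟩
    refine mem_convexHull_of_exists_fintype (Fin.cons (1 - ∑ i, c i) c : Fin (n + 1) → ℝ) x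
      (fun k => ?_) ?_ (fun k => mem_range_self k) ?_
    · induction k using Fin.cases with
      | zero => simpa using hc.2
      | succ k => simpa using hc.1 k
    · simp [Fin.sum_univ_succ]
    · ext i
      simp [simplexParam_apply, Fin.sum_univ_succ]

theorem volume_real_convexHull_range (x : Fin (n + 1) → EuclideanSpace ℝ (Fin n)) :
    volume.real (convexHull ℝ (range x)) = |(edgeMatrix x).det| / n.factorial := by
  rw [convexHull_range_eq_image_signedSimplex, Measure.real, volume_simplexParam_image,
    volume_signedSimplex n zero_le_one le_rfl, ENNReal.toReal_mul, signedVolume_one_zero,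
    ENNReal.toReal_ofReal (abs_nonneg _), ENNReal.toReal_ofReal (by positivity)]
  ring

/-- For numbers `λ j` with sum `1`, the sum of the positive parts exceeds that of the negative parts
by `1`, so `∑ |λ j| ≤ 1 + 2 * u` bounds the two sums by `1 + u` and `u`. Omitting `λ 0` does not
increase them. -/
theorem edgeCoords_mem_signedSimplex {y : EuclideanSpace ℝ (Fin n)} {u : ℝ}
    (h : ∑ j, |bary x y j| ≤ 1 + 2 * u) : edgeCoords x y ∈ signedSimplex n (1 + u) u := by
  set c := edgeCoords x y with hc
  have h1 : ∑ i, |c i| = ∑ i, max (c i) 0 + ∑ i, max (-c i) 0 := by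
    rw [← Finset.sum_add_distrib]
    refine Finset.sum_congr rfl fun i _ => ?_
    rcases le_total 0 (c i) with hi | hi
    · simp [hi, abs_of_nonneg]
    · simp [hi, abs_of_nonpos]
  have h2 : ∑ i, c i = ∑ i, max (c i) 0 - ∑ i, max (-c i) 0 := by
    rw [← Finset.sum_sub_distrib]
    refine Finset.sum_congr rfl fun i _ => ?_
    rcases le_total 0 (c i) with hi | hi <;> simp [hi]
  rw [bary, Fin.sum_univ_succ] at h
  simp only [Fin.cons_zero, Fin.cons_succ, ← hc, h1, h2] at h
  have h3 := le_abs_self (1 - (∑ i, max (c i) 0 - ∑ i, max (-c i) 0))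
  have h4 := neg_abs_le (1 - (∑ i, max (c i) 0 - ∑ i, max (-c i) 0))
  exact ⟨by linarith, by linarith⟩

/-- A set on which the Lebesgue function `∑ |λ j|` of a simplex is at most `t` has volume at most
`legendre n t` times the volume of the simplex. -/
theorem volume_real_le_of_sum_abs_bary_le (hx : (edgeMatrix x).det ≠ 0)
    {s : Set (EuclideanSpace ℝ (Fin n))} {t : ℝ} (ht : 1 ≤ t)
    (h : ∀ y ∈ s, ∑ j, |bary x y j| ≤ t) :
    volume.real s ≤ (legendre n).eval t * volume.real (convexHull ℝ (range x)) := by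
  obtain ⟨u, rfl⟩ : ∃ u : ℝ, t = 1 + 2 * u := ⟨(t - 1) / 2, by ring⟩
  have hu : 0 ≤ u := by linarith
  have hsub : s ⊆ simplexParam x '' signedSimplex n (1 + u) u := fun y hy =>
    ⟨edgeCoords x y, edgeCoords_mem_signedSimplex (h y hy), simplexParam_edgeCoords hx y⟩
  have hvol := volume_simplexParam_image x (signedSimplex n (1 + u) u)
  rw [volume_signedSimplex n (by linarith) hu] at hvol
  calc volume.real s ≤ volume.real (simplexParam x '' signedSimplex n (1 + u) u) :=
        measureReal_mono hsub (by rw [hvol]; finiteness)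
    _ = _ := by
        rw [Measure.real, hvol, ENNReal.toReal_mul, ENNReal.toReal_ofReal (abs_nonneg _),
          ENNReal.toReal_ofReal (signedVolume_nonneg n (by linarith) hu),
          ← factorial_mul_signedVolume, volume_real_convexHull_range]
        field_simp

end Simplex

/-! ### The norm of an interpolation projector -/

section Projector

variable {n : ℕ}

theorem continuous_edgeMatrix :
    Continuous (edgeMatrix : (Fin (n + 1) → EuclideanSpace ℝ (Fin n)) → _) :=
  continuous_matrix fun i j => by simp only [edgeMatrix, Matrix.of_apply]; fun_prop

theorem continuous_bary_vertices {T : Type*} [TopologicalSpace T]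
    {x : T → Fin (n + 1) → EuclideanSpace ℝ (Fin n)} {y : T → EuclideanSpace ℝ (Fin n)}
    (hx : Continuous x) (hy : Continuous y) (hdet : ∀ t, (edgeMatrix (x t)).det ≠ 0)
    (j : Fin (n + 1)) : Continuous fun t => bary (x t) (y t) j := by
  have hM : Continuous fun t => edgeMatrix (x t) := continuous_edgeMatrix.comp hx
  have hc : Continuous fun t => edgeCoords (x t) (y t) := by
    simp only [edgeCoords, Matrix.inv_def, Ring.inverse_eq_inv']
    refine Continuous.matrix_mulVec ((hM.matrix_det.inv₀ hdet).smul hM.matrix_adjugate) ?_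
    fun_prop
  induction j using Fin.cases with
  | zero => simp only [bary, Fin.cons_zero]; fun_prop
  | succ k => simp only [bary, Fin.cons_succ]; fun_prop

theorem continuous_bary (x : Fin (n + 1) → EuclideanSpace ℝ (Fin n)) (j : Fin (n + 1)) :
    Continuous fun y => bary x y j := by
  obtain ⟨a, b, h⟩ := exists_bary_eq_affine x j
  simp only [h]
  fun_prop

variable {K : ConvexBody (EuclideanSpace ℝ (Fin n))}

/-- The vertices `x j`, as points of the ambient space. -/
def vertices (x : Fin (n + 1) → K) : Fin (n + 1) → EuclideanSpace ℝ (Fin n) :=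
  fun j => x j

theorem continuous_vertices :
    Continuous (vertices : (Fin (n + 1) → K) → Fin (n + 1) → EuclideanSpace ℝ (Fin n)) := by
  unfold vertices; fun_prop

theorem nondegenerate_iff {x : Fin (n + 1) → K} :
    Nondegenerate x ↔ (edgeMatrix (vertices x)).det ≠ 0 :=
  affineIndependent_iff_det_edgeMatrix_ne_zero

theorem simplexVolume_eq (x : Fin (n + 1) → K) :
    simplexVolume x = |(edgeMatrix (vertices x)).det| / n.factorial :=
  volume_real_convexHull_range (vertices x)

theorem continuous_simplexVolume :
    Continuous (simplexVolume : (Fin (n + 1) → K) → ℝ) := by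
  simp only [funext simplexVolume_eq]
  exact ((continuous_edgeMatrix.comp continuous_vertices).matrix_det.abs).div_const _

theorem nondegenerate_iff_simplexVolume_pos {x : Fin (n + 1) → K} :
    Nondegenerate x ↔ 0 < simplexVolume x := by
  rw [nondegenerate_iff, simplexVolume_eq, div_pos_iff_of_pos_right (by positivity), abs_pos]

/-- The Lebesgue function `∑ |λ j|` of a simplex, restricted to `K`. -/
noncomputable def lebesgueFunction (x : Fin (n + 1) → K) : C(K, ℝ) where
  toFun y := ∑ j, |bary (vertices x) y j|
  continuous_toFun := continuous_finsetSum _ fun j _ =>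
    ((continuous_bary (vertices x) j).comp continuous_subtype_val).abs

theorem continuousOn_lebesgueFunction {D : Set (Fin (n + 1) → K)}
    (hD : ∀ x ∈ D, Nondegenerate x) : ContinuousOn lebesgueFunction D := by
  rw [continuousOn_iff_continuous_domRestrict]
  refine ContinuousMap.continuous_of_continuous_uncurry _ ?_
  have hbary := continuous_bary_vertices (T := D × K) (x := fun p => vertices p.1.1)
    (y := fun p => p.2) (continuous_vertices.comp (by fun_prop)) (by fun_prop)
    (fun p => nondegenerate_iff.1 (hD _ p.1.2))
  exact continuous_finsetSum Finset.univ fun j _ => (hbary j).abs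

/-- The projector `f ↦ ∑ f (x j) λ j`. -/
noncomputable def baryProjector (x : Fin (n + 1) → K) : C(K, ℝ) →L[ℝ] C(K, ℝ) :=
  ∑ j, (ContinuousMap.evalCLM ℝ (x j)).smulRight
    (⟨fun y : K => bary (vertices x) y j,
      (continuous_bary (vertices x) j).comp continuous_subtype_val⟩ : C(K, ℝ))

theorem baryProjector_apply (x : Fin (n + 1) → K) (f : C(K, ℝ)) (y : K) :
    baryProjector x f y = ∑ j, bary (vertices x) y j * f (x j) := by
  simp [baryProjector, ContinuousMap.sum_apply, mul_comm]

theorem isInterpolationProjector_baryProjector {x : Fin (n + 1) → K} (hx : Nondegenerate x) :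
    IsInterpolationProjector x (baryProjector x) where
  linear f := by
    choose a b hab using exists_bary_eq_affine (vertices x)
    refine ⟨fun i => ∑ j, a j i * f (x j), ∑ j, b j * f (x j), fun y => ?_⟩
    simp only [baryProjector_apply, hab, add_mul, Finset.sum_add_distrib, Finset.sum_mul]
    rw [Finset.sum_comm]
    congr 1
    exact Finset.sum_congr rfl fun i _ => Finset.sum_congr rfl fun j _ => by ring
  interpolates f j := by
    have h : bary (vertices x) (x j) = Pi.single j 1 := bary_vertex (nondegenerate_iff.1 hx) j
    simp [baryProjector_apply, h, Pi.single_apply]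

theorem IsInterpolationProjector.apply_eq {x : Fin (n + 1) → K} {P : C(K, ℝ) →L[ℝ] C(K, ℝ)}
    (hP : IsInterpolationProjector x P) (hx : Nondegenerate x) (f : C(K, ℝ)) (y : K) :
    P f y = ∑ j, bary (vertices x) y j * f (x j) := by
  obtain ⟨a, b, h⟩ := hP.linear f
  rw [h, ← sum_bary_mul_affine (nondegenerate_iff.1 hx)]
  refine Finset.sum_congr rfl fun j _ => ?_
  rw [← hP.interpolates f j, h]
  rfl

theorem IsInterpolationProjector.norm_eq {x : Fin (n + 1) → K} {P : C(K, ℝ) →L[ℝ] C(K, ℝ)}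
    (hP : IsInterpolationProjector x P) (hx : Nondegenerate x) : ‖P‖ = ‖lebesgueFunction x‖ := by
  refine le_antisymm (P.opNorm_le_bound (norm_nonneg _) fun f => ?_) ?_
  · refine (ContinuousMap.norm_le _ (by positivity)).2 fun y => ?_
    rw [hP.apply_eq hx, Real.norm_eq_abs]
    calc |∑ j, bary (vertices x) y j * f (x j)|
        ≤ ∑ j, |bary (vertices x) y j * f (x j)| := Finset.abs_sum_le_sum_abs _ _
      _ ≤ ∑ j, |bary (vertices x) y j| * ‖f‖ := Finset.sum_le_sum fun j _ => by
          rw [abs_mul]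
          exact mul_le_mul_of_nonneg_left (f.norm_coe_le_norm (x j)) (abs_nonneg _)
      _ = lebesgueFunction x y * ‖f‖ := by rw [← Finset.sum_mul]; rfl
      _ ≤ ‖lebesgueFunction x‖ * ‖f‖ :=
          mul_le_mul_of_nonneg_right ((le_abs_self (lebesgueFunction x y)).trans
            ((lebesgueFunction x).norm_coe_le_norm y)) (norm_nonneg _)
  · refine (ContinuousMap.norm_le _ (norm_nonneg P)).2 fun y => ?_
    -- The value at `y` is attained on the affine function with the values `sign (λ j y)` at the
    -- nodes, truncated to `[-1, 1]`.
    let f : C(K, ℝ) :=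
      ⟨fun z => max (-1) (min 1
        (∑ j, bary (vertices x) z j * (SignType.sign (bary (vertices x) y j) : ℝ))), by
        have := fun j => (continuous_bary (vertices x) j).comp
          (continuous_subtype_val (p := fun z => z ∈ K))
        simp only [Function.comp_def] at this
        fun_prop⟩
    have hf : ‖f‖ ≤ 1 := (ContinuousMap.norm_le _ zero_le_one).2 fun z =>
      abs_le.2 ⟨le_max_left _ _, max_le (by norm_num) (min_le_left _ _)⟩
    have hfx : ∀ k, f (x k) = SignType.sign (bary (vertices x) y k) := fun k => by
      have h : bary (vertices x) (x k) = Pi.single k 1 := bary_vertex (nondegenerate_iff.1 hx) k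
      have hs : ∀ s : SignType, max (-1 : ℝ) (min 1 (s : ℝ)) = s := by
        intro s; cases s <;> simp
      simp [f, h, Pi.single_apply, hs]
    have hPf : P f y = lebesgueFunction x y := by
      rw [hP.apply_eq hx]
      exact Finset.sum_congr rfl fun j _ => by rw [hfx, self_mul_sign]
    calc ‖lebesgueFunction x y‖ = ‖P f y‖ := by rw [hPf]
      _ ≤ ‖P f‖ := (P f).norm_coe_le_norm y
      _ ≤ ‖P‖ * ‖f‖ := P.le_opNorm f
      _ ≤ ‖P‖ := mul_le_of_le_one_right (norm_nonneg P) hf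

theorem one_le_norm_lebesgueFunction (x : Fin (n + 1) → K) : 1 ≤ ‖lebesgueFunction x‖ := by
  refine le_trans ?_ ((lebesgueFunction x).norm_coe_le_norm (x 0))
  refine le_trans ?_ (le_abs_self _)
  calc (1 : ℝ) = ∑ j, bary (vertices x) (x 0) j := (sum_bary _ _).symm
    _ ≤ ∑ j, |bary (vertices x) (x 0) j| := Finset.sum_le_sum fun j _ => le_abs_self _

theorem volume_real_le_legendre_mul_simplexVolume {x : Fin (n + 1) → K} (hx : Nondegenerate x) :
    volume.real (K : Set (EuclideanSpace ℝ (Fin n))) ≤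
      (legendre n).eval ‖lebesgueFunction x‖ * simplexVolume x :=
  volume_real_le_of_sum_abs_bary_le (nondegenerate_iff.1 hx) (one_le_norm_lebesgueFunction x)
    fun y hy => (le_abs_self _).trans ((lebesgueFunction x).norm_coe_le_norm ⟨y, hy⟩)

theorem mem_projectorNorms_iff {r : ℝ} :
    r ∈ projectorNorms K ↔
      ∃ x : Fin (n + 1) → K, Nondegenerate x ∧ r = ‖lebesgueFunction x‖ := by
  constructor
  · rintro ⟨x, P, hx, hP, rfl⟩
    exact ⟨x, hx, hP.norm_eq hx⟩
  · rintro ⟨x, hx, rfl⟩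
    have hP := isInterpolationProjector_baryProjector hx
    exact ⟨x, _, hx, hP, (hP.norm_eq hx).symm⟩

/-! ### Existence of the extremal simplices -/

theorem exists_nondegenerate (hK : (interior (K : Set (EuclideanSpace ℝ (Fin n)))).Nonempty) :
    ∃ x : Fin (n + 1) → K, Nondegenerate x := by
  obtain ⟨p, hp⟩ := hK
  obtain ⟨r, hr, hball⟩ := Metric.isOpen_iff.1 isOpen_interior p hp
  have hmem : ∀ i : Fin n, p + EuclideanSpace.single i (r / 2) ∈ K := fun i =>
    interior_subset (hball (by simp [abs_of_pos hr, hr]))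
  let x : Fin (n + 1) → K := Fin.cons ⟨p, interior_subset hp⟩ fun i => ⟨_, hmem i⟩
  refine ⟨x, nondegenerate_iff.2 ?_⟩
  have h : edgeMatrix (vertices x) = (r / 2) • (1 : Matrix (Fin n) (Fin n) ℝ) := by
    ext i j
    simp [edgeMatrix, vertices, x, Matrix.one_apply]
  rw [h, Matrix.det_smul, Matrix.det_one]
  positivity

theorem isGreatest_maxSimplexVolume
    (hK : (interior (K : Set (EuclideanSpace ℝ (Fin n)))).Nonempty) :
    IsGreatest (simplexVolumes K) (maxSimplexVolume K) := by
  obtain ⟨x₀, hx₀⟩ := exists_nondegenerate hK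
  obtain ⟨x, -, hx⟩ := isCompact_univ.exists_isMaxOn ⟨x₀, mem_univ _⟩
    (continuous_simplexVolume (K := K)).continuousOn
  have hmax : IsGreatest (simplexVolumes K) (simplexVolume x) := by
    refine ⟨⟨x, ?_, rfl⟩, ?_⟩
    · rw [nondegenerate_iff_simplexVolume_pos] at hx₀ ⊢
      exact hx₀.trans_le (hx (mem_univ x₀))
    · rintro _ ⟨z, -, rfl⟩
      exact hx (mem_univ z)
  rwa [maxSimplexVolume, hmax.csSup_eq]

theorem volume_real_pos (hK : (interior (K : Set (EuclideanSpace ℝ (Fin n)))).Nonempty) :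
    0 < volume.real (K : Set (EuclideanSpace ℝ (Fin n))) :=
  ENNReal.toReal_pos (Measure.measure_pos_of_nonempty_interior _ hK).ne' K.isCompact.measure_ne_top

/-- A projector of norm at most `‖P₀‖` has a simplex of volume at least
`vol K / legendre n ‖P₀‖`. The tuples with this bound form a compact set of nondegenerate
simplices, on which the norm depends continuously on the nodes. -/
theorem isLeast_theta (hn : 1 ≤ n)
    (hK : (interior (K : Set (EuclideanSpace ℝ (Fin n)))).Nonempty) :
    IsLeast (projectorNorms K) (theta K) := by
  obtain ⟨x₀, hx₀⟩ := exists_nondegenerate hK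
  set γ := ‖lebesgueFunction x₀‖ with hγ
  have hγ1 : 1 ≤ γ := one_le_norm_lebesgueFunction x₀
  have hL : 0 < (legendre n).eval γ := one_pos.trans_le (one_le_eval_legendre hn hγ1)
  set δ := volume.real (K : Set (EuclideanSpace ℝ (Fin n))) / (legendre n).eval γ with hδ
  have hδ0 : 0 < δ := div_pos (volume_real_pos hK) hL
  have hmem : ∀ x : Fin (n + 1) → K, Nondegenerate x → ‖lebesgueFunction x‖ ≤ γ →
      δ ≤ simplexVolume x := fun x hx hxγ => by
    rw [hδ, div_le_iff₀' hL]
    refine (volume_real_le_legendre_mul_simplexVolume hx).trans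
      (mul_le_mul_of_nonneg_right ?_ measureReal_nonneg)
    exact (strictMonoOn_legendre hn).monotoneOn (one_le_norm_lebesgueFunction x) hγ1 hxγ
  let D : Set (Fin (n + 1) → K) := {x | δ ≤ simplexVolume x}
  have hDnd : ∀ x ∈ D, Nondegenerate x := fun x hx =>
    nondegenerate_iff_simplexVolume_pos.2 (hδ0.trans_le hx)
  have hDc : IsCompact D := (isClosed_le continuous_const continuous_simplexVolume).isCompact
  obtain ⟨x, hxD, hx⟩ := hDc.exists_isMinOn ⟨x₀, hmem x₀ hx₀ le_rfl⟩
    (continuousOn_lebesgueFunction hDnd).norm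
  have hmin : IsLeast (projectorNorms K) ‖lebesgueFunction x‖ := by
    refine ⟨mem_projectorNorms_iff.2 ⟨x, hDnd x hxD, rfl⟩, fun r hr => ?_⟩
    obtain ⟨z, hz, rfl⟩ := mem_projectorNorms_iff.1 hr
    rcases le_total ‖lebesgueFunction z‖ γ with h | h
    · exact hx (hmem z hz h)
    · exact (hx (hmem x₀ hx₀ le_rfl)).trans h
  rwa [theta, hmin.csInf_eq]

theorem simplexVolume_le_volume_real (x : Fin (n + 1) → K) :
    simplexVolume x ≤ volume.real (K : Set (EuclideanSpace ℝ (Fin n))) :=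
  measureReal_mono (convexHull_min (by rintro _ ⟨j, rfl⟩; exact (x j).2) K.convex)
    K.isCompact.measure_ne_top

end Projector

end LinearInterpolation

theorem mainTheorem1 (n : ℕ) (hn : 1 ≤ n) (K : ConvexBody (EuclideanSpace ℝ (Fin n)))
    (hK : (interior (K : Set (EuclideanSpace ℝ (Fin n)))).Nonempty) :
    Set.BijOn (fun t : ℝ => (LinearInterpolation.legendre n).eval t) (Set.Ici 1) (Set.Ici 1) ∧
    IsGreatest (LinearInterpolation.simplexVolumes K) (LinearInterpolation.maxSimplexVolume K) ∧
    IsLeast (LinearInterpolation.projectorNorms K) (LinearInterpolation.theta K) ∧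
    1 ≤ MeasureTheory.volume.real (K : Set (EuclideanSpace ℝ (Fin n))) /
      LinearInterpolation.maxSimplexVolume K ∧
    LinearInterpolation.legendreInv n
        (MeasureTheory.volume.real (K : Set (EuclideanSpace ℝ (Fin n))) /
          LinearInterpolation.maxSimplexVolume K) ≤
      LinearInterpolation.theta K := by
  open LinearInterpolation in
  have hmax := isGreatest_maxSimplexVolume hK
  have hmin := isLeast_theta hn hK
  obtain ⟨z, hz, hzV⟩ := hmax.1
  have hV : 0 < maxSimplexVolume K := by
    rw [hzV]; exact nondegenerate_iff_simplexVolume_pos.1 hz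
  have hratio : 1 ≤ volume.real (K : Set (EuclideanSpace ℝ (Fin n))) / maxSimplexVolume K := by
    rw [one_le_div hV, hzV]
    exact simplexVolume_le_volume_real z
  refine ⟨bijOn_legendre hn, hmax, hmin, hratio, ?_⟩
  obtain ⟨x, hx, hθ⟩ := mem_projectorNorms_iff.1 hmin.1
  have hθ1 : 1 ≤ theta K := by rw [hθ]; exact one_le_norm_lebesgueFunction x
  refine legendreInv_le hn hratio hθ1 ?_
  rw [div_le_iff₀ hV]
  calc volume.real (K : Set (EuclideanSpace ℝ (Fin n)))
      ≤ (legendre n).eval (theta K) * simplexVolume x := by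
        rw [hθ]; exact volume_real_le_legendre_mul_simplexVolume hx
    _ ≤ (legendre n).eval (theta K) * maxSimplexVolume K :=
        mul_le_mul_of_nonneg_left (hmax.2 ⟨x, hx, rfl⟩)
          (zero_le_one.trans (one_le_eval_legendre hn hθ1))
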